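/- Write $\mathbb N=\{1,2,\dots\}$, $\mathbb N_0=\mathbb N\cup\{0\}$, let $(a)_n=a(a+1)\cdots(a+n-1)$ be the Pochhammer symbol, and let $|y|$ denote the sum of the entries of $y$. Let $d,N\in\mathbb N$ and let $\ell=(\ell_1,\dots,\ell_{d+1})\in\mathbb N^{d+1}$ satisfy $\ell_i\le N$ for all $i$ and $\ell_i+\ell_j\ge N$ for $1\le i<j\le d+1$. Let $$V_{\ell,N}^d=\{x\in\mathbb N_0^d:\ x_i\le\ell_i\ (1\le i\le d),\ N-\ell_{d+1}\le|x|\le N\},$$ $$\mathsf H_{\ell,N}(x)=\frac{N!}{(-|\ell|)_N}\prod_{i=1}^d\frac{(-\ell_i)_{x_i}}{x_i!}\cdot\frac{(-\ell_{d+1})_{N-|x|}}{(N-|x|)!},\qquad \langle f,g\rangle_{\ell,N}=\sum_{x\in V_{\ell,N}^d}f(x)g(x)\,\mathsf H_{\ell,N}(x).$$ For $x,\nu$ with $d$ entries put $|\mathbf x_{j-1}|=x_1+\dots+x_{j-1}$, $|\boldsymbol\nu^{j+1}|=\nu_{j+1}+\dots+\nu_d$, $|\boldsymbol\ell^{j+1}|=\ell_{j+1}+\dots+\ell_{d+1}$,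 and $a_j=-|\boldsymbol\ell^{j+1}|+2|\boldsymbol\nu^{j+1}|-1$. Let $$H_{\ell,N}^d=\{\nu\in\mathbb N_0^d:\ |\nu|\le N,\ |\nu|\le|\ell|-N,\ \nu_j\le\ell_j,\ 2|\boldsymbol\nu^{j+1}|\le|\boldsymbol\ell^{j+1}|-\nu_j\ (1\le j\le d)\}.$$ With the classical Hahn polynomials $\mathsf Q_n(t;a,b,M)={}_3F_2(-n,\,n+a+b+1,\,-t;\ a+1,\,-M;\ 1)$, a sum over $0\le k\le n$, define for $\nu\in H_{\ell,N}^d$ the polynomial in $x=(x_1,\dots,x_d)$ $$\mathsf Q_\nu(x;\ell,N)=\frac{(-1)^{|\nu|}}{(-N)_{|\nu|}}\prod_{j=1}^d\frac{(-\ell_j)_{\nu_j}}{(a_j+1)_{\nu_j}}\,(-N+|\mathbf x_{j-1}|+|\boldsymbol\nu^{j+1}|)_{\nu_j}\;\mathsf Q_{\nu_j}(x_j;-\ell_j-1,a_j,N-|\mathbf x_{j-1}|-|\boldsymbol\nu^{j+1}|),$$ where the product of the last two factors is understood as a polynomial in $x$, after cancelling $(-M)_{n}/(-M)_k=(-M+k)_{n-k}$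 in each term. Let $\mathcal I(V_{\ell,N}^d)$ be the ideal of the polynomials in $\mathbb R[x_1,\dots,x_d]$ that vanish on $V_{\ell,N}^d$, and $\Pi_{\ell,N}^d=\mathbb R[x_1,\dots,x_d]/\mathcal I(V_{\ell,N}^d)$. Then: (i) For all $\nu,\mu\in H_{\ell,N}^d$, $\langle\mathsf Q_\nu(\cdot;\ell,N),\mathsf Q_\mu(\cdot;\ell,N)\rangle_{\ell,N}=\mathsf B_\nu(\ell,N)\,\delta_{\nu,\mu}$, where $$\mathsf B_\nu(\ell,N)=\frac{(-1)^{|\nu|}(-|\ell|)_{N+|\nu|}}{(-N)_{|\nu|}(-|\ell|)_N(-|\ell|)_{2|\nu|}}\prod_{j=1}^d\frac{(-\ell_j+a_j)_{2\nu_j}\,(-\ell_j)_{\nu_j}\,\nu_j!}{(-\ell_j+a_j)_{\nu_j}\,(a_j+1)_{\nu_j}}.$$ (ii) The classes of the polynomials $\mathsf Q_\nu(\cdot;\ell,N)$, $\nu\in H_{\ell,N}^d$, form a basis of $\Pi_{\ell,N}^d$ (indexed by $H_{\ell,N}^d$). In particular, $|H_{\ell,N}^d|=|V_{\ell,N}^d|=\dim\Pi_{\ell,N}^d$.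 -/

import Mathlib

open MvPolynomial

namespace PolyHahn

noncomputable section

/-- The Pochhammer symbol `(a)_n = a (a + 1) ⋯ (a + n - 1)`. -/
def poch {R : Type*} [CommRing R] (a : R) (n : ℕ) : R := (ascPochhammer R n).eval a

/-- `|y|`, the sum of the entries of `y`, used for `x`, `ν` and `ℓ = (ℓ_1, …, ℓ_{d+1})`.
Throughout, the indices `1, …, d + 1` are the elements of `Fin (d + 1)`, and the indices `1, …, d`
are those of `Fin d`, embedded by `Fin.castSucc`. -/
def total {d : ℕ} (y : Fin d → ℕ) : ℕ := ∑ i, y i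

/-- `|ℓ^{j+1}| = ℓ_{j+1} + ⋯ + ℓ_{d+1}` for `1 ≤ j ≤ d`. -/
def ellTail {d : ℕ} (ℓ : Fin (d + 1) → ℕ) (j : Fin d) : ℕ := ∑ i ∈ Finset.Ioi j.castSucc, ℓ i

/-- `|ν^{j+1}| = ν_{j+1} + ⋯ + ν_d` for `1 ≤ j ≤ d`. -/
def nuTail {d : ℕ} (ν : Fin d → ℕ) (j : Fin d) : ℕ := ∑ i ∈ Finset.Ioi j, ν i

/-- The discrete polyhedron of the `x ∈ ℕ₀^d` with `x_i ≤ ℓ_i` for `1 ≤ i ≤ d` and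
`N - ℓ_{d+1} ≤ |x| ≤ N`. -/
def V {d : ℕ} (ℓ : Fin (d + 1) → ℕ) (N : ℕ) : Finset (Fin d → ℕ) :=
  (Finset.Iic fun i : Fin d => ℓ i.castSucc).filter fun x =>
    N ≤ total x + ℓ (Fin.last d) ∧ total x ≤ N

theorem mem_V {d : ℕ} (ℓ : Fin (d + 1) → ℕ) (N : ℕ) (x : Fin d → ℕ) :
    x ∈ V ℓ N ↔ (∀ i : Fin d, x i ≤ ℓ i.castSucc) ∧ N ≤ total x + ℓ (Fin.last d) ∧ total x ≤ N := by
  simp [V, Pi.le_def]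

/-- The index set of the `ν ∈ ℕ₀^d` with `|ν| ≤ N`, `|ν| ≤ |ℓ| - N` and, for `1 ≤ j ≤ d`,
`ν_j ≤ ℓ_j` and `2 |ν^{j+1}| ≤ |ℓ^{j+1}| - ν_j`. -/
def H {d : ℕ} (ℓ : Fin (d + 1) → ℕ) (N : ℕ) : Finset (Fin d → ℕ) :=
  (Finset.Iic fun j : Fin d => ℓ j.castSucc).filter fun ν =>
    total ν ≤ N ∧ total ν + N ≤ total ℓ ∧ ∀ j : Fin d, 2 * nuTail ν j + ν j ≤ ellTail ℓ j

theorem mem_H {d : ℕ} (ℓ : Fin (d + 1) → ℕ) (N : ℕ) (ν : Fin d → ℕ) :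
    ν ∈ H ℓ N ↔ (∀ j : Fin d, ν j ≤ ℓ j.castSucc) ∧
      total ν ≤ N ∧ total ν + N ≤ total ℓ ∧ ∀ j : Fin d, 2 * nuTail ν j + ν j ≤ ellTail ℓ j := by
  simp [H, Pi.le_def]

/-- The weight function, at the points of the polyhedron (where `|x| ≤ N`). -/
def weight {d : ℕ} (ℓ : Fin (d + 1) → ℕ) (N : ℕ) (x : Fin d → ℕ) : ℝ :=
  (N.factorial : ℝ) / poch (-(total ℓ : ℝ)) N *
    (∏ i : Fin d, poch (-(ℓ i.castSucc : ℝ)) (x i) / ((x i).factorial : ℝ)) *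
    (poch (-(ℓ (Fin.last d) : ℝ)) (N - total x) / ((N - total x).factorial : ℝ))

/-- The point of `ℝ^d` given by a lattice point. -/
def toReal {d : ℕ} (x : Fin d → ℕ) : Fin d → ℝ := fun i => (x i : ℝ)

/-- `⟨f, g⟩ = ∑_{x ∈ V} f(x) g(x) H(x)`. -/
def inner {d : ℕ} (ℓ : Fin (d + 1) → ℕ) (N : ℕ) (f g : MvPolynomial (Fin d) ℝ) : ℝ :=
  ∑ x ∈ V ℓ N, eval (toReal x) f * eval (toReal x) g * weight ℓ N x

/-- The ideal of the real polynomials that vanish on the polyhedron. -/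
def vanishing {d : ℕ} (ℓ : Fin (d + 1) → ℕ) (N : ℕ) : Ideal (MvPolynomial (Fin d) ℝ) :=
  vanishingIdeal ℝ (toReal '' (V ℓ N : Set (Fin d → ℕ)))

/-- The space `Π = ℝ[x_1, …, x_d] / I(V)`. -/
abbrev PiSpace {d : ℕ} (ℓ : Fin (d + 1) → ℕ) (N : ℕ) : Type :=
  MvPolynomial (Fin d) ℝ ⧸ vanishing ℓ N

/-- The classical Hahn polynomial `Q_n(x; a, b, M) = ₃F₂(-n, n + a + b + 1, -x; a + 1, -M; 1)`. -/
def hahn {K : Type*} [Field K] (n : ℕ) (x a b M : K) : K :=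
  ∑ k ∈ Finset.range (n + 1),
    poch (-(n : K)) k * poch (n + a + b + 1) k * poch (-x) k /
      (poch (a + 1) k * poch (-M) k * (k.factorial : K))

/-- The product `(-M)_n Q_n(x; a, b, M)`, a polynomial in `x` and `M`, written without the
denominators `(-M)_k` by means of `(-M)_n / (-M)_k = (-M + k)_{n-k}`. -/
def hahnCleared {R : Type*} [CommRing R] [Algebra ℝ R] (n : ℕ) (x : R) (a b : ℝ) (M : R) : R :=
  ∑ k ∈ Finset.range (n + 1),
    algebraMap ℝ R (poch (-(n : ℝ)) k * poch (n + a + b + 1) k /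
      (poch (a + 1) k * (k.factorial : ℝ))) * poch (-x) k * poch (-M + k) (n - k)

/-- `a_j = -|ℓ^{j+1}| + 2 |ν^{j+1}| - 1`. -/
def aParam {d : ℕ} (ℓ : Fin (d + 1) → ℕ) (ν : Fin d → ℕ) (j : Fin d) : ℝ :=
  -(ellTail ℓ j : ℝ) + 2 * (nuTail ν j : ℝ) - 1

/-- `N - |x_{j-1}| - |ν^{j+1}|`, where `|x_{j-1}| = x_1 + ⋯ + x_{j-1}`. -/
def mParam {d : ℕ} (N : ℕ) (ν : Fin d → ℕ) (j : Fin d) : MvPolynomial (Fin d) ℝ :=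
  C (N : ℝ) - ∑ i ∈ Finset.Iio j, X i - C (nuTail ν j : ℝ)

/-- The Hahn polynomial on the polyhedron,
`Q_ν(x) = (-1)^{|ν|} / (-N)_{|ν|} ∏_{j=1}^d (-ℓ_j)_{ν_j} / (a_j + 1)_{ν_j} ·
  (-N + |x_{j-1}| + |ν^{j+1}|)_{ν_j} Q_{ν_j}(x_j; -ℓ_j - 1, a_j, N - |x_{j-1}| - |ν^{j+1}|)`.
The last two factors together are polynomial in `x`; see `hahnPoly_eq`. -/
def hahnPoly {d : ℕ} (ℓ : Fin (d + 1) → ℕ) (N : ℕ) (ν : Fin d → ℕ) : MvPolynomial (Fin d) ℝ :=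
  C ((-1) ^ total ν / poch (-(N : ℝ)) (total ν)) *
    ∏ j : Fin d, (C (poch (-(ℓ j.castSucc : ℝ)) (ν j) / poch (aParam ℓ ν j + 1) (ν j)) *
      hahnCleared (ν j) (X j) (-(ℓ j.castSucc : ℝ) - 1) (aParam ℓ ν j) (mParam N ν j))

/-- The squared norm `B_ν`. -/
def B {d : ℕ} (ℓ : Fin (d + 1) → ℕ) (N : ℕ) (ν : Fin d → ℕ) : ℝ :=
  (-1) ^ total ν * poch (-(total ℓ : ℝ)) (N + total ν) /
      (poch (-(N : ℝ)) (total ν) * poch (-(total ℓ : ℝ)) N * poch (-(total ℓ : ℝ)) (2 * total ν)) *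
    ∏ j : Fin d,
      poch (-(ℓ j.castSucc : ℝ) + aParam ℓ ν j) (2 * ν j) * poch (-(ℓ j.castSucc : ℝ)) (ν j) *
          ((ν j).factorial : ℝ) /
        (poch (-(ℓ j.castSucc : ℝ) + aParam ℓ ν j) (ν j) * poch (aParam ℓ ν j + 1) (ν j))

theorem poch_add {R : Type*} [CommRing R] (a : R) (m n : ℕ) :
    poch a (m + n) = poch a m * poch (a + m) n := by
  simp [poch, ← ascPochhammer_mul]

theorem poch_map {R S : Type*} [CommRing R] [CommRing S] (f : R →+* S) (a : R) (n : ℕ) :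
    f (poch a n) = poch (f a) n := by
  simp only [poch]
  rw [← ascPochhammer_map f, Polynomial.eval_map, Polynomial.eval₂_hom]

theorem hahnCleared_map {R S : Type*} [CommRing R] [CommRing S] [Algebra ℝ R] [Algebra ℝ S]
    (f : R →ₐ[ℝ] S) (n : ℕ) (x : R) (a b : ℝ) (M : R) :
    f (hahnCleared n x a b M) = hahnCleared n (f x) a b (f M) := by
  simp only [hahnCleared, map_sum, map_mul, AlgHom.commutes]
  refine Finset.sum_congr rfl fun k _ => ?_
  have h1 := poch_map f.toRingHom (-x) k
  have h2 := poch_map f.toRingHom (-M + k) (n - k)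
  simp only [AlgHom.toRingHom_eq_coe, RingHom.coe_coe, map_neg, map_add, map_natCast] at h1 h2
  rw [h1, h2]

theorem hahnCleared_eq {K : Type*} [Field K] [Algebra ℝ K] (n : ℕ) (x : K) (a b : ℝ) (M : K)
    (hM : poch (-M) n ≠ 0) :
    hahnCleared n x a b M =
      poch (-M) n * hahn n x (algebraMap ℝ K a) (algebraMap ℝ K b) M := by
  simp only [hahnCleared, hahn, Finset.mul_sum]
  refine Finset.sum_congr rfl fun k hk => ?_
  have hkn : k ≤ n := Nat.lt_succ_iff.mp (Finset.mem_range.mp hk)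
  have h := poch_add (-M) k (n - k)
  rw [Nat.add_sub_cancel' hkn] at h
  have hk0 : poch (-M) k ≠ 0 := fun h0 => hM (by rw [h, h0, zero_mul])
  simp only [map_div₀, map_mul, poch_map, map_add, map_neg, map_natCast, map_one]
  rw [h]
  field_simp

theorem poch_ne_zero {R : Type*} [CommRing R] [IsDomain R] (a : R) (n : ℕ)
    (h : ∀ i < n, a + (i : R) ≠ 0) : poch a n ≠ 0 := by
  induction n with
  | zero => simp [poch]
  | succ n ih =>
    rw [poch_add]
    refine mul_ne_zero (ih fun i hi => h i (by omega)) ?_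
    simpa [poch] using h n (by omega)

/-- In the field of rational functions, `hahnPoly` is given by the product formula for `Q_ν`. -/
theorem hahnPoly_eq {d : ℕ} (ℓ : Fin (d + 1) → ℕ) (N : ℕ) (ν : Fin d → ℕ) (hν : total ν ≤ N) :
    let K := FractionRing (MvPolynomial (Fin d) ℝ)
    let x : Fin d → K := fun i => algebraMap (MvPolynomial (Fin d) ℝ) K (X i)
    let M : Fin d → K := fun j => (N : K) - ∑ i ∈ Finset.Iio j, x i - (nuTail ν j : K)
    let a : Fin d → K := fun j => -(ellTail ℓ j : K) + 2 * (nuTail ν j : K) - 1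
    algebraMap (MvPolynomial (Fin d) ℝ) K (hahnPoly ℓ N ν) =
      (-1) ^ total ν / poch (-(N : K)) (total ν) *
        ∏ j : Fin d, (poch (-(ℓ j.castSucc : K)) (ν j) / poch (a j + 1) (ν j) *
          poch (-(M j)) (ν j) * hahn (ν j) (x j) (-(ℓ j.castSucc : K) - 1) (a j) (M j)) := by
  intro K x M a
  have hC : ∀ r : ℝ, algebraMap (MvPolynomial (Fin d) ℝ) K (C r) = algebraMap ℝ K r := fun r => by
    rw [← MvPolynomial.algebraMap_eq, ← IsScalarTower.algebraMap_apply]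
  have hMj : ∀ j, algebraMap (MvPolynomial (Fin d) ℝ) K (mParam N ν j) = M j := fun j => by
    simp only [mParam, map_sub, map_sum, map_natCast]; rfl
  have haj : ∀ j, algebraMap ℝ K (aParam ℓ ν j) = a j := fun j => by
    simp [aParam, a, map_ofNat (algebraMap ℝ K) 2]
  simp only [hahnPoly, map_mul, map_prod, hC, map_div₀, map_pow, map_neg, map_one, poch_map,
    map_natCast, map_add, haj]
  congr 1
  refine Finset.prod_congr rfl fun j _ => ?_
  have hpos : poch (-(mParam N ν j)) (ν j) ≠ 0 := by
    refine poch_ne_zero _ _ fun i hi h0 => ?_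
    have h1 := congrArg (eval (fun _ : Fin d => (0 : ℝ))) h0
    simp only [mParam, map_add, map_neg, map_sub, map_sum, eval_X, map_natCast, map_zero,
      Finset.sum_const_zero] at h1
    have h2 : nuTail ν j + ν j ≤ total ν := by
      rw [nuTail, total, add_comm, ← Finset.sum_insert (by simp)]
      exact Finset.sum_le_sum_of_subset (Finset.subset_univ _)
    have h3 : ((i + nuTail ν j : ℕ) : ℝ) = (N : ℝ) := by push_cast; linarith
    have h4 : i + nuTail ν j = N := by exact_mod_cast h3
    omega
  have hne : poch (-(M j)) (ν j) ≠ 0 := by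
    rw [← hMj, ← map_neg, ← poch_map]
    exact (map_ne_zero_iff _ (IsFractionRing.injective (MvPolynomial (Fin d) ℝ) K)).mpr hpos
  have h := hahnCleared_map (IsScalarTower.toAlgHom ℝ (MvPolynomial (Fin d) ℝ) K) (ν j) (X j)
    (-(ℓ j.castSucc : ℝ) - 1) (aParam ℓ ν j) (mParam N ν j)
  simp only [IsScalarTower.coe_toAlgHom'] at h
  rw [h, hMj, hahnCleared_eq _ _ _ _ _ hne, haj]
  simp only [map_sub, map_neg, map_natCast, map_one]
  ring

end

end PolyHahn

/-!
Everything reduces to one variable by summing out the last coordinate. For fixed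
`x_1, …, x_{d-1}` with sum at most `N`, put `M = N - |x_{d-1}|`; the variables `x_d` and `M - x_d`
carry the weight `binom(a, x_d) binom(b, M - x_d)` with `a = ℓ_d`, `b = ℓ_{d+1}`, and the last
factors of `Q_ν` and `Q_μ` are one-variable Hahn polynomials of degrees `n = ν_d` and `m = μ_d`.
Their inner product vanishes for `n ≠ m` (`hahnPair_of_ne`), and for `n = m` it is a constant times
`binom(a + b - 2n, M - n)` (`hahnPair_self`). This is again a binomial weight, so that what remains
is the same problem in `d - 1` variables, with `N - n` for `N` and with `a + b - 2n` in place of the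
two last entries of `ℓ` (`merge`, `polyPair_snoc`). Induction on `d` gives the orthogonality and the
norms (`polyPair_eq`), which are then compared with `B`.

In one variable the polynomials `h_n(x, M) = (-M)_n Q_n(x; -a-1, -b-1, M)` form strings under an
`sl₂` action on the functions on `{x + y = M}`, `M = 0, 1, 2, …`. The raising operator takes
`h_n(·, M)` to a multiple of `h_n(·, M + 1)`, the lowering operator takes `h_n(·, M + 1)` to a
multiple of `h_n(·, M)`, and the two are adjoint for the binomial weights. Moving one of them across
the inner product gives a recursion in `M` (`hahnPair_succ`). For `n ≠ m`, the recursions obtained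
from the two sides force the inner products to vanish. For `n = m`, the recursion reduces the norm
to the case `M = n`, where `h_n` is a quotient of Pochhammer symbols (`hahnNum_top`) and the norm is
a Vandermonde sum (`hahnPair_top`).

The index set `H` obeys the same recursion in `d` as the orthogonality, and by the Clebsch-Gordan
rule so does the number of points of `V`; hence `|H| = |V|` (`card_H_eq_card_V`). The `Q_ν` are
orthogonal with nonzero norms, therefore they form a basis of the functions on `V`. In particular
every function on `V` is the restriction of a polynomial, which identifies `Π` with the space of
these functions.
-/

namespace PolyHahn

noncomputable section

/-! ### Pochhammer symbols -/

theorem poch_zero {R : Type*} [CommRing R] (a : R) : poch a 0 = 1 := by simp [poch]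

theorem poch_succ {R : Type*} [CommRing R] (a : R) (n : ℕ) :
    poch a (n + 1) = poch a n * (a + n) := by
  rw [poch_add]; simp [poch]

theorem poch_succ_left {R : Type*} [CommRing R] (a : R) (n : ℕ) :
    poch a (n + 1) = a * poch (a + 1) n := by
  rw [add_comm n 1, poch_add]; simp [poch]

theorem poch_neg_natCast_mul (p k : ℕ) :
    poch (-((p + k : ℕ) : ℝ)) k * (p.factorial : ℝ) = (-1) ^ k * ((p + k).factorial : ℝ) := by
  induction k generalizing p with
  | zero => simp [poch_zero]
  | succ k ih =>
    have h := ih p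
    rw [poch_succ_left, show -((p + (k + 1) : ℕ) : ℝ) + 1 = -((p + k : ℕ) : ℝ) by push_cast; ring,
      mul_assoc, h, ← add_assoc, Nat.factorial_succ]
    push_cast
    ring

/-- `(-m)_k = (-1)^k m! / (m - k)!` for `k ≤ m`, with `m = p + k`. -/
theorem poch_neg_natCast (p k : ℕ) :
    poch (-((p + k : ℕ) : ℝ)) k = (-1) ^ k * ((p + k).factorial : ℝ) / (p.factorial : ℝ) := by
  rw [eq_div_iff (by positivity), poch_neg_natCast_mul]

theorem poch_neg_natCast_ne_zero {m k : ℕ} (h : k ≤ m) : poch (-(m : ℝ)) k ≠ 0 := by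
  refine poch_ne_zero _ _ fun i hi h0 => ?_
  have : (i : ℝ) = m := by linarith
  have : i = m := by exact_mod_cast this
  omega

theorem poch_natCast_add_one (q k : ℕ) :
    poch ((q : ℝ) + 1) k = ((q + k).factorial : ℝ) / (q.factorial : ℝ) := by
  induction k with
  | zero => rw [poch_zero, add_zero, div_self (by positivity)]
  | succ k ih =>
    rw [poch_succ, ih, ← add_assoc, Nat.factorial_succ]
    push_cast
    ring

/-! ### Raising and lowering operators in one variable -/

theorem hahnCleared_real (n : ℕ) (x a b M : ℝ) :
    hahnCleared n x a b M = ∑ k ∈ Finset.range (n + 1),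
      poch (-(n : ℝ)) k * poch (n + a + b + 1) k / (poch (a + 1) k * (k.factorial : ℝ)) *
        poch (-x) k * poch (-M + k) (n - k) := rfl

/-- The raising operator `f ↦ (x, y) ↦ x f(x - 1, y) + y f(x, y - 1)`, with `y = M + 1 - x`. The
identity holds for each term of the sum. -/
theorem hahnCleared_raise (n : ℕ) (x a b M : ℝ) :
    x * hahnCleared n (x - 1) a b M + (M + 1 - x) * hahnCleared n x a b M =
      (M + 1 - n) * hahnCleared n x a b (M + 1) := by
  simp only [hahnCleared_real, Finset.mul_sum, ← Finset.sum_add_distrib]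
  refine Finset.sum_congr rfl fun k hk => ?_
  obtain ⟨m, rfl⟩ := Nat.exists_eq_add_of_le (Nat.lt_succ_iff.mp (Finset.mem_range.mp hk))
  have h1 : x * poch (-(x - 1)) k = (x - k) * poch (-x) k := by
    have := poch_succ (-x) k
    rw [poch_succ_left] at this
    rw [show -(x - 1) = -x + 1 by ring]
    linear_combination -this
  have h2 : (M + 1 - k) * poch (-M + k) m = (M + 1 - (k + m)) * poch (-(M + 1) + k) m := by
    have := poch_succ (-(M + 1) + k : ℝ) m
    rw [poch_succ_left] at this
    rw [show -M + (k : ℝ) = -(M + 1) + k + 1 by ring]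
    linear_combination -this
  rw [Nat.add_sub_cancel_left]
  push_cast
  generalize poch (-((k : ℝ) + m)) k * poch ((k : ℝ) + m + a + b + 1) k /
    (poch (a + 1) k * (k.factorial : ℝ)) = c
  linear_combination c * poch (-M + k) m * h1 + c * poch (-x) k * h2

/-- The lowering operator `f ↦ (x, y) ↦ (a - x) f(x + 1, y) + (b - y) f(x, y + 1)`, with
`y = M - x`. -/
theorem hahnCleared_lower (n : ℕ) (x a b M : ℝ) (ha : poch (-a) n ≠ 0) :
    (a - x) * hahnCleared n (x + 1) (-a - 1) (-b - 1) (M + 1) +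
        (b - M + x) * hahnCleared n x (-a - 1) (-b - 1) (M + 1) =
      (a + b - n - M) * hahnCleared n x (-a - 1) (-b - 1) M := by
  set c : ℕ → ℝ := fun k => poch (-(n : ℝ)) k * poch (n + (-a - 1) + (-b - 1) + 1) k /
    (poch (-a - 1 + 1) k * (k.factorial : ℝ)) with hc
  have hck : ∀ k, poch (-(n : ℝ)) k * poch (n + (-a - 1) + (-b - 1) + 1) k /
    (poch (-a - 1 + 1) k * (k.factorial : ℝ)) = c k := fun _ => rfl
  -- The terms of the two sides differ by `G (k + 1) - G k`, which telescopes.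
  set G : ℕ → ℝ := fun k =>
    k * (a - k + 1) * c k * poch (-M - 1 + k) (n - k) * poch (-x) (k - 1) with hG
  have hG0 : G 0 = 0 := by simp [hG]
  have hGn : G (n + 1) = 0 := by
    have : poch (-(n : ℝ)) (n + 1) = 0 := by rw [poch_succ]; ring
    simp [hG, hc, this]
  rw [← sub_eq_zero]
  simp only [hahnCleared_real, Finset.mul_sum, ← Finset.sum_add_distrib, ← Finset.sum_sub_distrib,
    hck]
  rw [← sub_zero (0 : ℝ)]
  nth_rewrite 1 [← hGn]
  rw [← hG0, ← Finset.sum_range_sub]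
  refine Finset.sum_congr rfl fun k hk => ?_
  obtain ⟨m, rfl⟩ := Nat.exists_eq_add_of_le (Nat.lt_succ_iff.mp (Finset.mem_range.mp hk))
  have hD : (a - x) * poch (-(x + 1)) k + (b - M + x) * poch (-x) k =
      (a + b - M - k) * poch (-x) k - k * (a - k + 1) * poch (-x) (k - 1) := by
    cases k with
    | zero => simp only [poch_zero]; push_cast; ring
    | succ k =>
      rw [poch_succ_left, show -(x + 1) + 1 = -x by ring, Nat.add_sub_cancel, poch_succ]
      push_cast
      ring
  rw [Nat.add_sub_cancel_left]
  cases m with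
  | zero =>
    rw [add_zero] at hGn hG ⊢
    rw [hGn]
    simp only [hG, Nat.sub_self, poch_zero]
    linear_combination c k * hD
  | succ m =>
    have hne : poch (-a) (k + 1) ≠ 0 := fun h0 => ha <| by
      rw [show k + (m + 1) = k + 1 + m by ring, poch_add, h0, zero_mul]
    rw [poch_succ, mul_ne_zero_iff] at hne
    have hS : c (k + 1) * ((k + 1) * (a - k)) = c k * (m + 1) * (m + 2 * k - a - b) := by
      have h1 : poch (-a - 1 + 1) k ≠ 0 := by rw [sub_add_cancel]; exact hne.1
      have h2 : -a + (k : ℝ) ≠ 0 := hne.2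
      simp only [hc, poch_succ, Nat.factorial_succ]
      rw [show -a - 1 + 1 + (k : ℝ) = -a + k by ring, show a - (k : ℝ) = -(-a + k) by ring]
      push_cast
      field_simp
      ring
    have hZ : poch (-(M + 1) + k) (m + 1) = (-(M + 1) + k) * poch (-M + k) m := by
      rw [poch_succ_left]
      congr 2
      ring
    have hG1 : G (k + 1) =
        (k + 1) * (a - k) * c (k + 1) * poch (-M + k) m * poch (-x) k := by
      simp only [hG, Nat.add_sub_cancel]
      rw [show k + (m + 1) - (k + 1) = m by omega]
      push_cast
      rw [show -M - 1 + ((k : ℝ) + 1) = -M + k by ring]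
      ring
    have hG2 : G k =
        k * (a - k + 1) * c k * ((-(M + 1) + k) * poch (-M + k) m) * poch (-x) (k - 1) := by
      simp only [hG, Nat.add_sub_cancel_left]
      rw [← hZ, show -M - 1 + (k : ℝ) = -(M + 1) + k by ring]
    rw [hG1, hG2, hZ, poch_succ (-M + (k : ℝ)) m]
    push_cast
    linear_combination c k * ((-(M + 1) + k) * poch (-M + k) m) * hD -
      poch (-M + k) m * poch (-x) k * hS

/-! ### Orthogonality and norms in one variable -/

/-- The value of `(-M)_n Q_n(x; -a-1, -b-1, M)`, with the denominators `(-M)_k` cleared, at natural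
numbers. -/
def hahnNum (a b n x M : ℕ) : ℝ := hahnCleared n (x : ℝ) (-(a : ℝ) - 1) (-(b : ℝ) - 1) (M : ℝ)

/-- The inner product of the Hahn polynomials of degrees `n` and `m` on the pairs `(x, y)` with
`x + y = M`, for the weight `binom(a, x) binom(b, y)`. -/
def hahnPair (a b n m M : ℕ) : ℝ :=
  ∑ p ∈ Finset.HasAntidiagonal.antidiagonal M,
    (a.choose p.1 : ℝ) * (b.choose p.2 : ℝ) * (hahnNum a b n p.1 M * hahnNum a b m p.1 M)

theorem hahnPair_comm (a b n m M : ℕ) : hahnPair a b n m M = hahnPair a b m n M :=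
  Finset.sum_congr rfl fun p _ => by ring

theorem choose_succ_mul_succ (a x : ℕ) :
    (a.choose (x + 1) : ℝ) * ((x : ℝ) + 1) = a.choose x * (a - x) := by
  rcases le_or_gt x a with h | h
  · have := Nat.choose_succ_right_eq a x
    rw [← Nat.cast_sub h]
    exact_mod_cast this
  · rw [Nat.choose_eq_zero_of_lt h, Nat.choose_eq_zero_of_lt (by omega)]
    simp

/-- The raising and the lowering operator are adjoint for the binomial weight. -/
theorem sum_raise_mul (a b M : ℕ) (f g : ℕ → ℝ) :
    ∑ p ∈ Finset.HasAntidiagonal.antidiagonal (M + 1), (a.choose p.1 : ℝ) * (b.choose p.2 : ℝ) *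
        ((p.1 * f (p.1 - 1) + p.2 * f p.1) * g p.1) =
      ∑ p ∈ Finset.HasAntidiagonal.antidiagonal M, (a.choose p.1 : ℝ) * (b.choose p.2 : ℝ) *
        (f p.1 * ((a - p.1) * g (p.1 + 1) + (b - p.2) * g p.1)) := by
  simp only [add_mul, mul_add, Finset.sum_add_distrib]
  congr 1
  · rw [Finset.Nat.sum_antidiagonal_succ]
    simp only [Nat.cast_zero, zero_mul, mul_zero, zero_add]
    refine Finset.sum_congr rfl fun p _ => ?_
    have := choose_succ_mul_succ a p.1
    rw [Nat.add_sub_cancel]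
    push_cast
    linear_combination b.choose p.2 * f p.1 * g (p.1 + 1) * this
  · rw [Finset.Nat.sum_antidiagonal_succ']
    simp only [Nat.cast_zero, zero_mul, mul_zero, zero_add]
    refine Finset.sum_congr rfl fun p _ => ?_
    have := choose_succ_mul_succ b p.2
    push_cast
    linear_combination a.choose p.1 * f p.1 * g p.1 * this

theorem hahnNum_raise (a b n M x y : ℕ) (h : x + y = M + 1) :
    x * hahnNum a b n (x - 1) M + y * hahnNum a b n x M =
      (M + 1 - n) * hahnNum a b n x (M + 1) := by
  have h1 := hahnCleared_raise n x (-(a : ℝ) - 1) (-(b : ℝ) - 1) M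
  have hy : (y : ℝ) = M + 1 - x := by
    have : (x : ℝ) + y = M + 1 := by exact_mod_cast h
    linarith
  rw [hy]
  simp only [hahnNum]
  cases x with
  | zero => simpa using h1
  | succ x =>
    push_cast at h1 ⊢
    rw [add_sub_cancel_right] at h1
    exact h1

theorem hahnNum_lower (a b n M x y : ℕ) (hn : n ≤ a) (h : x + y = M) :
    (a - x) * hahnNum a b n (x + 1) (M + 1) + (b - y) * hahnNum a b n x (M + 1) =
      (a + b - n - M) * hahnNum a b n x M := by
  have h1 := hahnCleared_lower n x a b M (poch_neg_natCast_ne_zero hn)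
  have hy : (y : ℝ) = M - x := by rw [← h]; push_cast; ring
  rw [hy]
  simp only [hahnNum]
  push_cast
  linear_combination h1

/-- The recursion in `M` that results from moving the raising operator across the inner product. -/
theorem hahnPair_succ (a b n m M : ℕ) (hm : m ≤ a) :
    ((M : ℝ) + 1 - n) * hahnPair a b n m (M + 1) = (a + b - m - M) * hahnPair a b n m M := by
  calc _ = ∑ p ∈ Finset.HasAntidiagonal.antidiagonal (M + 1),
      (a.choose p.1 : ℝ) * (b.choose p.2 : ℝ) *
        ((p.1 * hahnNum a b n (p.1 - 1) M + p.2 * hahnNum a b n p.1 M) *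
          hahnNum a b m p.1 (M + 1)) := by
        rw [hahnPair, Finset.mul_sum]
        refine Finset.sum_congr rfl fun p hp => ?_
        rw [hahnNum_raise a b n M p.1 p.2 (Finset.HasAntidiagonal.mem_antidiagonal.mp hp)]
        ring
    _ = _ := by
        rw [sum_raise_mul a b M (fun x => hahnNum a b n x M) (fun x => hahnNum a b m x (M + 1)),
          hahnPair, Finset.mul_sum]
        refine Finset.sum_congr rfl fun p hp => ?_
        rw [hahnNum_lower a b m M p.1 p.2 hm (Finset.HasAntidiagonal.mem_antidiagonal.mp hp)]
        ring

/-- Orthogonality of the Hahn polynomials. Taking the adjoint on either side gives two recursions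
in `M`, which are compatible only if all the inner products vanish. -/
theorem hahnPair_of_ne {a b n m : ℕ} (hna : n ≤ a) (hma : m ≤ a) (hmb : m ≤ b)
    (hnm : n ≠ m) (M : ℕ) : hahnPair a b n m M = 0 := by
  -- The difference of the two recursions, divided by `m - n`.
  have key : ∀ M, hahnPair a b n m (M + 1) = -hahnPair a b n m M := fun M => by
    have h1 := hahnPair_succ a b n m M hma
    have h2 := hahnPair_succ a b m n M hna
    rw [hahnPair_comm a b m n, hahnPair_comm a b m n] at h2
    have h3 : (m : ℝ) - n ≠ 0 := sub_ne_zero.mpr fun h => hnm (by exact_mod_cast h.symm)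
    refine mul_left_cancel₀ h3 ?_
    linear_combination h1 - h2
  have h1 := hahnPair_succ a b n m M hma
  rw [key] at h1
  have h4 : (a : ℝ) + b + 1 - n - m ≠ 0 := by
    have : (n : ℝ) ≤ a := by exact_mod_cast hna
    have : (m : ℝ) ≤ b := by exact_mod_cast hmb
    intro h
    linarith
  refine (mul_eq_zero.mp ?_).resolve_left h4
  linear_combination -h1

theorem hahnNum_eq_zero (a b : ℕ) {n x M : ℕ} (hx : x ≤ M) (hM : M < n) :
    hahnNum a b n x M = 0 := by
  induction M generalizing x with
  | zero =>
    -- At `x = 0`, `M = -1` both coefficients on the left vanish.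
    have h := hahnCleared_raise n x (-(a : ℝ) - 1) (-(b : ℝ) - 1) (-1)
    obtain rfl : x = 0 := by omega
    have hn : (n : ℝ) ≠ 0 := by exact_mod_cast hM.ne'
    simpa [hn, hahnNum] using h
  | succ M ih =>
    have h := hahnNum_raise a b n M x (M + 1 - x) (by omega)
    have hn : (M : ℝ) + 1 - n ≠ 0 := fun h0 => by
      have : (M : ℝ) + 1 = n := by linarith
      have : M + 1 = n := by exact_mod_cast this
      omega
    refine (mul_eq_zero.mp ?_).resolve_left hn
    rw [← h, ih (by omega) (by omega)]
    rcases Nat.eq_or_lt_of_le hx with rfl | hx'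
    · simp
    · rw [ih (by omega) (by omega)]; ring

/-- At `M = n` the Hahn polynomial is a quotient of Pochhammer symbols: it is annihilated by the
lowering operator. -/
theorem hahnNum_top (a b n x : ℕ) (hn : n ≤ a) (hx : x ≤ n) :
    hahnNum a b n x n * poch (-(a : ℝ)) x =
      (-1) ^ n * (n.factorial : ℝ) * poch ((b : ℝ) - n + 1) x := by
  induction x with
  | zero =>
    have h0 : ∀ k, poch (0 : ℝ) (k + 1) = 0 := fun k => by rw [poch_succ_left, zero_mul]
    have := poch_neg_natCast 0 n
    rw [zero_add] at this
    rw [hahnNum, hahnCleared_real, Finset.sum_range_succ', Finset.sum_eq_zero]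
    · simp [poch_zero, this]
    · intro k _
      simp [h0]
  | succ x ih =>
    obtain ⟨M, rfl⟩ : ∃ M, n = M + 1 := ⟨n - 1, by omega⟩
    have h := hahnNum_lower a b (M + 1) M x (M - x) hn (by omega)
    rw [hahnNum_eq_zero a b (show x ≤ M by omega) (Nat.lt_succ_self M), mul_zero,
      Nat.cast_sub (by omega)] at h
    have := ih (by omega)
    rw [poch_succ, poch_succ]
    push_cast at *
    linear_combination (-poch (-(a : ℝ)) x) * h + (b - M + x) * this

/-- The Vandermonde identity for the coefficients of the powers of `1 / (1 - X)`. -/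
theorem sum_antidiagonal_choose_add_mul (p q n : ℕ) :
    ∑ s ∈ Finset.HasAntidiagonal.antidiagonal n, (p + s.1).choose p * (q + s.2).choose q =
      (p + q + 1 + n).choose n := by
  have h := congrArg (PowerSeries.coeff n) (pow_add (PowerSeries.mk 1 : PowerSeries ℤ)
    (p + 1) (q + 1))
  rw [show p + 1 + (q + 1) = p + q + 1 + 1 by ring, PowerSeries.mk_one_pow_eq_mk_choose_add,
    PowerSeries.mk_one_pow_eq_mk_choose_add, PowerSeries.mk_one_pow_eq_mk_choose_add,
    PowerSeries.coeff_mul] at h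
  simp only [PowerSeries.coeff_mk] at h
  rw [← Nat.choose_symm_add]
  exact_mod_cast h.symm

/-- The squared norm of the Hahn polynomial of degree `n` on `{x + y = n}`. On `{x + y = M}` it gets
the factor `binom(a + b - 2n, M - n)`. -/
def normFactor (a b n : ℕ) : ℝ :=
  (n.factorial : ℝ) ^ 2 * (poch (-(b : ℝ)) n / poch (-(a : ℝ)) n) * ((a + b + 1 - n).choose n : ℝ)

theorem poch_neg_natCast_div (p q n : ℕ) :
    poch (-((q + n : ℕ) : ℝ)) n / poch (-((p + n : ℕ) : ℝ)) n =
      (q + n).factorial * p.factorial / ((p + n).factorial * q.factorial) := by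
  have hn : ((-1 : ℝ) ^ n) ≠ 0 := by simp
  rw [poch_neg_natCast, poch_neg_natCast]
  field_simp

theorem hahnPair_top (p q n : ℕ) :
    hahnPair (p + n) (q + n) n n n = normFactor (p + n) (q + n) n := by
  have h := sum_antidiagonal_choose_add_mul q p n
  rw [normFactor, show p + n + (q + n) + 1 - n = q + p + 1 + n by omega, ← h, hahnPair,
    poch_neg_natCast_div, Nat.cast_sum, Finset.mul_sum]
  refine Finset.sum_congr rfl fun s hs => ?_
  obtain ⟨x, y⟩ := s
  obtain rfl : x + y = n := Finset.HasAntidiagonal.mem_antidiagonal.mp hs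
  have h1 := hahnNum_top (p + (x + y)) (q + (x + y)) (x + y) x (by omega) (by omega)
  have hx := poch_neg_natCast (p + y) x
  rw [show p + y + x = p + (x + y) by ring] at hx
  rw [hx, show ((q + (x + y) : ℕ) : ℝ) - (x + y : ℕ) + 1 = (q : ℝ) + 1 by push_cast; ring,
    poch_natCast_add_one] at h1
  have h2 : hahnNum (p + (x + y)) (q + (x + y)) (x + y) x (x + y) =
      (-1) ^ y * ((x + y).factorial : ℝ) * ((q + x).factorial / q.factorial) *
        ((p + y).factorial / (p + (x + y)).factorial) := by
    have : ((-1 : ℝ) ^ x) ^ 2 = 1 := by rw [← pow_mul, mul_comm, pow_mul]; simp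
    rw [pow_add] at h1
    field_simp at h1 ⊢
    linear_combination h1
  have hy : ((-1 : ℝ) ^ y) ^ 2 = 1 := by rw [← pow_mul, mul_comm, pow_mul]; simp
  have e1 := Nat.cast_add_choose ℝ (a := x) (b := p + y)
  have e2 := Nat.cast_add_choose ℝ (a := y) (b := q + x)
  have e3 := Nat.cast_add_choose ℝ (a := q) (b := x)
  have e4 := Nat.cast_add_choose ℝ (a := p) (b := y)
  rw [show x + (p + y) = p + (x + y) by ring] at e1
  rw [show y + (q + x) = q + (x + y) by ring] at e2
  simp only [h2, Nat.cast_mul, e1, e2, e3, e4]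
  field_simp
  linear_combination hy

theorem hahnPair_self {a b n : ℕ} (ha : n ≤ a) (hb : n ≤ b) (M : ℕ) :
    hahnPair a b n n M =
      if n ≤ M then normFactor a b n * ((a + b - 2 * n).choose (M - n) : ℝ) else 0 := by
  split_ifs with hM
  · obtain ⟨k, rfl⟩ := Nat.exists_eq_add_of_le hM
    obtain ⟨p, rfl⟩ := Nat.exists_eq_add_of_le' ha
    obtain ⟨q, rfl⟩ := Nat.exists_eq_add_of_le' hb
    rw [show p + n + (q + n) - 2 * n = p + q by omega]
    induction k with
    | zero => simp [hahnPair_top]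
    | succ k ih =>
      have h := hahnPair_succ (p + n) (q + n) n n (n + k) ha
      rw [ih (by omega)] at h
      have hc := choose_succ_mul_succ (p + q) k
      rw [Nat.add_sub_cancel_left] at h ⊢
      push_cast at h hc
      have hk : (k : ℝ) + 1 ≠ 0 := by positivity
      refine mul_left_cancel₀ hk ?_
      rw [← add_assoc]
      linear_combination h - normFactor (p + n) (q + n) n * hc
  · refine Finset.sum_eq_zero fun s hs => ?_
    have := Finset.HasAntidiagonal.mem_antidiagonal.mp hs
    rw [hahnNum_eq_zero a b (show s.1 ≤ M by omega) (by omega)]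
    ring

theorem normFactor_pos {a b n : ℕ} (ha : n ≤ a) (hb : n ≤ b) : 0 < normFactor a b n := by
  obtain ⟨p, rfl⟩ := Nat.exists_eq_add_of_le' ha
  obtain ⟨q, rfl⟩ := Nat.exists_eq_add_of_le' hb
  have hc : 0 < (p + n + (q + n) + 1 - n).choose n := Nat.choose_pos (by omega)
  rw [normFactor, poch_neg_natCast_div]
  positivity

/-! ### Splitting off the last coordinate -/

theorem sum_Iic_snoc {A : Type*} [AddCommMonoid A] {d : ℕ} (f : Fin (d + 1) → ℕ)
    (g : (Fin (d + 1) → ℕ) → A) :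
    ∑ x ∈ Finset.Iic f, g x =
      ∑ x ∈ Finset.Iic fun i : Fin d => f i.castSucc, ∑ t ∈ Finset.Iic (f (Fin.last d)),
        g (Fin.snoc x t : Fin (d + 1) → ℕ) := by
  rw [← Finset.sum_product']
  refine Finset.sum_bij' (fun x _ => (Fin.init x, x (Fin.last d)))
    (fun p _ => (Fin.snoc p.1 p.2 : Fin (d + 1) → ℕ)) ?_ ?_ ?_ ?_ ?_
  · intro x hx
    rw [Finset.mem_Iic] at hx
    simp only [Finset.mem_product, Finset.mem_Iic]
    exact ⟨fun i => hx i.castSucc, hx _⟩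
  · intro p hp
    simp only [Finset.mem_product, Finset.mem_Iic] at hp ⊢
    intro i
    refine Fin.lastCases ?_ (fun i => ?_) i
    · simpa using hp.2
    · simpa using hp.1 i
  · intro x _
    simp
  · intro p _
    simp
  · intro x _
    simp

theorem sum_Ioi_castSucc {A : Type*} [AddCommMonoid A] {d : ℕ} (f : Fin (d + 1) → A) (j : Fin d) :
    ∑ i ∈ Finset.Ioi j.castSucc, f i = ∑ i ∈ Finset.Ioi j, f i.castSucc + f (Fin.last d) := by
  rw [← Finset.filter_lt_eq_Ioi, ← Finset.filter_lt_eq_Ioi, Finset.sum_filter, Finset.sum_filter,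
    Fin.sum_univ_castSucc]
  simp [Fin.castSucc_lt_last]

theorem sum_Iio_castSucc {A : Type*} [AddCommMonoid A] {d : ℕ} (f : Fin (d + 1) → A) (j : Fin d) :
    ∑ i ∈ Finset.Iio j.castSucc, f i = ∑ i ∈ Finset.Iio j, f i.castSucc := by
  rw [← Finset.filter_gt_eq_Iio, ← Finset.filter_gt_eq_Iio, Finset.sum_filter, Finset.sum_filter,
    Fin.sum_univ_castSucc]
  simp [(Fin.castSucc_lt_last j).not_gt]

theorem sum_Iio_last {A : Type*} [AddCommMonoid A] {d : ℕ} (f : Fin (d + 1) → A) :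
    ∑ i ∈ Finset.Iio (Fin.last d), f i = ∑ i, f (Fin.castSucc i) := by
  rw [← Finset.filter_gt_eq_Iio, Finset.sum_filter, Fin.sum_univ_castSucc]
  simp [Fin.castSucc_lt_last]

/-- The parameters left when the last coordinate has been summed out in degree `n`: the two last
entries of `ℓ` are replaced by their sum minus `2 n`. -/
def merge {d : ℕ} (ℓ : Fin (d + 2) → ℕ) (n : ℕ) : Fin (d + 1) → ℕ :=
  Fin.snoc (fun i : Fin d => ℓ i.castSucc.castSucc)
    (ℓ (Fin.last d).castSucc + ℓ (Fin.last (d + 1)) - 2 * n)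

section merge

variable {d : ℕ} (ℓ : Fin (d + 2) → ℕ) (n : ℕ)

@[simp] theorem merge_castSucc (i : Fin d) : merge ℓ n i.castSucc = ℓ i.castSucc.castSucc := by
  simp [merge]

@[simp] theorem merge_last :
    merge ℓ n (Fin.last d) = ℓ (Fin.last d).castSucc + ℓ (Fin.last (d + 1)) - 2 * n := by
  simp [merge]

@[simp] theorem total_snoc (x : Fin d → ℕ) (t : ℕ) :
    total (Fin.snoc x t : Fin (d + 1) → ℕ) = total x + t := by
  simp [total, Fin.sum_univ_castSucc]

@[simp] theorem nuTail_snoc_castSucc (ν : Fin d → ℕ) (j : Fin d) :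
    nuTail (Fin.snoc ν n : Fin (d + 1) → ℕ) j.castSucc = nuTail ν j + n := by
  simp [nuTail, sum_Ioi_castSucc]

@[simp] theorem nuTail_last (ν : Fin (d + 1) → ℕ) : nuTail ν (Fin.last d) = 0 := by
  rw [nuTail, ← Fin.top_eq_last, Finset.Ioi_top, Finset.sum_empty]

@[simp] theorem ellTail_last : ellTail ℓ (Fin.last d) = ℓ (Fin.last (d + 1)) := by
  rw [ellTail, sum_Ioi_castSucc, ← Fin.top_eq_last d, Finset.Ioi_top, Finset.sum_empty, zero_add]

variable {ℓ n}

theorem ellTail_merge (ha : n ≤ ℓ (Fin.last d).castSucc) (hb : n ≤ ℓ (Fin.last (d + 1)))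
    (j : Fin d) : ellTail ℓ j.castSucc = ellTail (merge ℓ n) j + 2 * n := by
  rw [ellTail, ellTail, sum_Ioi_castSucc, sum_Ioi_castSucc, sum_Ioi_castSucc]
  simp only [merge_castSucc, merge_last]
  omega

theorem total_merge (ha : n ≤ ℓ (Fin.last d).castSucc) (hb : n ≤ ℓ (Fin.last (d + 1))) :
    total ℓ = total (merge ℓ n) + 2 * n := by
  simp only [total, Fin.sum_univ_castSucc, merge_castSucc, merge_last]
  omega

theorem aParam_snoc_castSucc (ha : n ≤ ℓ (Fin.last d).castSucc) (hb : n ≤ ℓ (Fin.last (d + 1)))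
    (ν : Fin d → ℕ) (j : Fin d) :
    aParam ℓ (Fin.snoc ν n : Fin (d + 1) → ℕ) j.castSucc = aParam (merge ℓ n) ν j := by
  rw [aParam, aParam, ellTail_merge ha hb, nuTail_snoc_castSucc]
  push_cast
  ring

theorem aParam_last (ν : Fin (d + 1) → ℕ) :
    aParam ℓ ν (Fin.last d) = -(ℓ (Fin.last (d + 1)) : ℝ) - 1 := by
  simp [aParam]

/-- The index set `H` obeys the recursion of `merge`. -/
theorem snoc_mem_H (N : ℕ) (ν : Fin d → ℕ) :
    (Fin.snoc ν n : Fin (d + 1) → ℕ) ∈ H ℓ N ↔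
      (n ≤ ℓ (Fin.last d).castSucc ∧ n ≤ ℓ (Fin.last (d + 1)) ∧ n ≤ N) ∧
        ν ∈ H (merge ℓ n) (N - n) := by
  simp only [mem_H, Fin.forall_fin_succ', total_snoc, Fin.snoc_castSucc, Fin.snoc_last,
    nuTail_snoc_castSucc, nuTail_last, ellTail_last, merge_castSucc]
  constructor
  · rintro ⟨⟨h1, h2⟩, h3, h4, h5, h6⟩
    have hb : n ≤ ℓ (Fin.last (d + 1)) := by omega
    rw [total_merge h2 hb] at h4
    refine ⟨⟨h2, hb, by omega⟩, h1, by omega, by omega, fun j => ?_⟩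
    have := h5 j
    rw [ellTail_merge h2 hb] at this
    omega
  · rintro ⟨⟨h2, hb, h3⟩, h1, h4, h5, h6⟩
    rw [total_merge h2 hb]
    refine ⟨⟨h1, h2⟩, by omega, by omega, fun j => ?_, by omega⟩
    rw [ellTail_merge h2 hb]
    have := h6 j
    omega

/-! ### Counting the index set and the polyhedron -/

variable (ℓ) in
theorem card_H_succ (N : ℕ) : (H ℓ N).card =
    ∑ n ∈ Finset.Iic (ℓ (Fin.last d).castSucc),
      if n ≤ ℓ (Fin.last (d + 1)) ∧ n ≤ N then (H (merge ℓ n) (N - n)).card else 0 := by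
  have h1 : ∀ {d : ℕ} (ℓ : Fin (d + 1) → ℕ) (N : ℕ), (H ℓ N).card =
      ∑ ν ∈ Finset.Iic fun j : Fin d => ℓ j.castSucc, if ν ∈ H ℓ N then 1 else 0 := by
    intro d ℓ N
    rw [← Finset.card_filter]
    congr 1
    ext ν
    simp only [Finset.mem_filter, Finset.mem_Iic, iff_and_self]
    exact fun h => ((mem_H ℓ N ν).mp h).1
  rw [h1, sum_Iic_snoc, Finset.sum_comm]
  refine Finset.sum_congr rfl fun n hn => ?_
  have ha : n ≤ ℓ (Fin.last d).castSucc := Finset.mem_Iic.mp hn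
  simp only [snoc_mem_H, ha, true_and]
  split_ifs with hc
  · rw [h1]
    simp [hc]
  · simp [hc]

/-- The Clebsch-Gordan rule, with `s` for `|x|`: both sides are the dimension of the component of
degree `N - s` of the tensor product of the `sl₂`-modules of highest weights `a` and `b`. On the left
it is counted in the product basis, on the right in the decomposition into modules of highest weights
`a + b - 2n` that start in degree `n`. -/
theorem sum_clebschGordan (a b s N : ℕ) :
    (∑ t ∈ Finset.Iic a, if N ≤ s + t + b ∧ s + t ≤ N then 1 else 0) =
      ∑ n ∈ Finset.Iic a, if n ≤ b ∧ n ≤ N then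
        if N - n ≤ s + (a + b - 2 * n) ∧ s ≤ N - n then 1 else 0 else 0 := by
  simp only [← ite_and]
  rw [← Finset.card_filter, ← Finset.card_filter]
  by_cases h : s ≤ N ∧ N ≤ s + a + b
  · have h1 : (Finset.Iic a).filter (fun t => N ≤ s + t + b ∧ s + t ≤ N) =
        Finset.Icc (N - s - b) (min a (N - s)) := by
      ext t
      simp only [Finset.mem_filter, Finset.mem_Iic, Finset.mem_Icc]
      omega
    have h2 : (Finset.Iic a).filter
        (fun n => (n ≤ b ∧ n ≤ N) ∧ N - n ≤ s + (a + b - 2 * n) ∧ s ≤ N - n) =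
        Finset.Icc 0 (min (min a b) (min (N - s) (s + a + b - N))) := by
      ext t
      simp only [Finset.mem_filter, Finset.mem_Iic, Finset.mem_Icc]
      omega
    rw [h1, h2, Nat.card_Icc, Nat.card_Icc]
    omega
  · rw [Finset.filter_false_of_mem, Finset.filter_false_of_mem]
    · intro n hn
      rw [Finset.mem_Iic] at hn
      omega
    · intro n hn
      rw [Finset.mem_Iic] at hn
      omega

variable (ℓ) in
theorem card_V_succ (N : ℕ) : (V ℓ N).card =
    ∑ n ∈ Finset.Iic (ℓ (Fin.last d).castSucc),
      if n ≤ ℓ (Fin.last (d + 1)) ∧ n ≤ N then (V (merge ℓ n) (N - n)).card else 0 := by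
  rw [V, Finset.card_filter, sum_Iic_snoc]
  simp only [total_snoc, sum_clebschGordan]
  rw [Finset.sum_comm]
  refine Finset.sum_congr rfl fun n hn => ?_
  split_ifs with hc
  · simp only [V, Finset.card_filter, merge_castSucc, merge_last]
  · simp

end merge

theorem card_H_eq_card_V {d : ℕ} (ℓ : Fin (d + 1) → ℕ) (N : ℕ) : (H ℓ N).card = (V ℓ N).card := by
  induction d generalizing N with
  | zero =>
    congr 1
    ext x
    simp [mem_H, mem_V, total]
  | succ d ih =>
    rw [card_H_succ, card_V_succ]
    simp only [ih]

/-! ### Orthogonality in several variables -/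

/-- The value at a lattice point of `hahnPoly` without its constant factors. -/
def hahnVal {d : ℕ} (ℓ : Fin (d + 1) → ℕ) (N : ℕ) (ν x : Fin d → ℕ) : ℝ :=
  ∏ j : Fin d, hahnCleared (ν j) (x j : ℝ) (-(ℓ j.castSucc : ℝ) - 1) (aParam ℓ ν j)
    ((N : ℝ) - ∑ i ∈ Finset.Iio j, (x i : ℝ) - (nuTail ν j : ℝ))

/-- The weight function up to normalization, as a product of binomial coefficients. -/
def binWeight {d : ℕ} (ℓ : Fin (d + 1) → ℕ) (N : ℕ) (x : Fin d → ℕ) : ℝ :=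
  (∏ i : Fin d, ((ℓ i.castSucc).choose (x i) : ℝ)) * ((ℓ (Fin.last d)).choose (N - total x) : ℝ)

/-- The inner product of the polynomials without their constant factors, for the binomial weight. -/
def polyPair {d : ℕ} (ℓ : Fin (d + 1) → ℕ) (N : ℕ) (ν μ : Fin d → ℕ) : ℝ :=
  ∑ x ∈ V ℓ N, hahnVal ℓ N ν x * hahnVal ℓ N μ x * binWeight ℓ N x

/-- The condition `N - ℓ_{d+1} ≤ |x|` may be dropped: the last binomial coefficient vanishes. -/
theorem polyPair_eq_sum {d : ℕ} (ℓ : Fin (d + 1) → ℕ) (N : ℕ) (ν μ : Fin d → ℕ) :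
    polyPair ℓ N ν μ = ∑ x ∈ Finset.Iic fun i : Fin d => ℓ i.castSucc,
      if total x ≤ N then hahnVal ℓ N ν x * hahnVal ℓ N μ x * binWeight ℓ N x else 0 := by
  rw [polyPair, V, Finset.sum_filter]
  refine Finset.sum_congr rfl fun x _ => ?_
  by_cases h : total x ≤ N
  · by_cases h' : N ≤ total x + ℓ (Fin.last d)
    · simp [h, h']
    · simp [h, h', binWeight, Nat.choose_eq_zero_of_lt (show ℓ (Fin.last d) < N - total x by omega)]
  · simp [h]

/-- The last factor depends on the other coordinates only through `|x|`, and the other factors on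
the last degree `n` only through the merged parameters. -/
theorem hahnVal_snoc {d N n : ℕ} {ℓ : Fin (d + 2) → ℕ} (ha : n ≤ ℓ (Fin.last d).castSucc)
    (hb : n ≤ ℓ (Fin.last (d + 1))) (hN : n ≤ N) (ν x : Fin d → ℕ) (t : ℕ) (hx : total x ≤ N) :
    hahnVal ℓ N (Fin.snoc ν n) (Fin.snoc x t) = hahnVal (merge ℓ n) (N - n) ν x *
      hahnNum (ℓ (Fin.last d).castSucc) (ℓ (Fin.last (d + 1))) n t (N - total x) := by
  rw [hahnVal, Fin.prod_univ_castSucc]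
  congr 1
  · refine Finset.prod_congr rfl fun j _ => ?_
    rw [aParam_snoc_castSucc ha hb, sum_Iio_castSucc, nuTail_snoc_castSucc, merge_castSucc,
      Nat.cast_sub hN]
    simp only [Fin.snoc_castSucc]
    congr 1
    push_cast
    ring
  · rw [aParam_last, sum_Iio_last, nuTail_last, hahnNum, Nat.cast_sub hx, total]
    simp

theorem sum_Iic_choose_mul (a M : ℕ) (g : ℕ → ℝ) :
    (∑ t ∈ Finset.Iic a, if t ≤ M then (a.choose t : ℝ) * g t else 0) =
      ∑ t ∈ Finset.range (M + 1), (a.choose t : ℝ) * g t := by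
  rw [← Finset.sum_filter]
  refine Finset.sum_subset (fun t => ?_) fun t ht hta => ?_
  · simp only [Finset.mem_filter, Finset.mem_Iic, Finset.mem_range]
    omega
  · simp only [Finset.mem_filter, Finset.mem_Iic, Finset.mem_range] at ht hta
    rw [Nat.choose_eq_zero_of_lt (by omega), Nat.cast_zero, zero_mul]

/-- Summing out the last coordinate. -/
theorem polyPair_snoc {d N n m : ℕ} {ℓ : Fin (d + 2) → ℕ} (hna : n ≤ ℓ (Fin.last d).castSucc)
    (hnb : n ≤ ℓ (Fin.last (d + 1))) (hnN : n ≤ N) (hma : m ≤ ℓ (Fin.last d).castSucc)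
    (hmb : m ≤ ℓ (Fin.last (d + 1))) (hmN : m ≤ N) (ν μ : Fin d → ℕ) :
    polyPair ℓ N (Fin.snoc ν n) (Fin.snoc μ m) = if n = m then
      normFactor (ℓ (Fin.last d).castSucc) (ℓ (Fin.last (d + 1))) n *
        polyPair (merge ℓ n) (N - n) ν μ else 0 := by
  have h1 : polyPair ℓ N (Fin.snoc ν n) (Fin.snoc μ m) =
      ∑ x ∈ Finset.Iic fun i : Fin d => ℓ i.castSucc.castSucc, if total x ≤ N then
        hahnVal (merge ℓ n) (N - n) ν x * hahnVal (merge ℓ m) (N - m) μ x *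
        (∏ i : Fin d, ((ℓ i.castSucc.castSucc).choose (x i) : ℝ)) *
        hahnPair (ℓ (Fin.last d).castSucc) (ℓ (Fin.last (d + 1))) n m (N - total x) else 0 := by
    rw [polyPair_eq_sum, sum_Iic_snoc]
    refine Finset.sum_congr rfl fun x _ => ?_
    split_ifs with hx
    · rw [hahnPair, Finset.Nat.sum_antidiagonal_eq_sum_range_succ_mk, Finset.mul_sum]
      simp only [mul_assoc, mul_left_comm _ (((ℓ (Fin.last d).castSucc).choose _ : ℕ) : ℝ)]
      rw [← sum_Iic_choose_mul]
      refine Finset.sum_congr rfl fun t _ => ?_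
      rw [total_snoc]
      refine if_congr (by omega) ?_ rfl
      rw [hahnVal_snoc hna hnb hnN _ _ _ hx, hahnVal_snoc hma hmb hmN _ _ _ hx, binWeight,
        Fin.prod_univ_castSucc, total_snoc, Nat.sub_add_eq]
      simp only [Fin.snoc_castSucc, Fin.snoc_last]
      ring
    · refine Finset.sum_eq_zero fun t _ => ?_
      rw [total_snoc, if_neg (by omega)]
  rw [h1]
  split_ifs with hnm
  · subst hnm
    rw [polyPair_eq_sum, Finset.mul_sum]
    simp only [merge_castSucc]
    refine Finset.sum_congr rfl fun x _ => ?_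
    rw [hahnPair_self hna hnb]
    by_cases hx : total x ≤ N - n
    · rw [if_pos hx, if_pos (by omega), if_pos (by omega), binWeight, merge_last,
        Nat.sub_right_comm]
      simp only [merge_castSucc]
      ring
    · rw [if_neg hx, mul_zero]
      split_ifs with h2 h3
      · omega
      · rw [mul_zero]
      · rfl
  · refine Finset.sum_eq_zero fun x _ => ?_
    rw [hahnPair_of_ne hna hma hmb hnm, mul_zero, ite_self]

/-- Orthogonality and norms for the binomial weight, by summing out the last coordinate
repeatedly. -/
theorem polyPair_eq {d : ℕ} {ℓ : Fin (d + 1) → ℕ} {N : ℕ} {ν μ : Fin d → ℕ} (hν : ν ∈ H ℓ N)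
    (hμ : μ ∈ H ℓ N) : polyPair ℓ N ν μ = if ν = μ then
      (∏ j : Fin d, normFactor (ℓ j.castSucc) (ellTail ℓ j - 2 * nuTail ν j) (ν j)) *
        ((total ℓ - 2 * total ν).choose (N - total ν) : ℝ) else 0 := by
  induction d generalizing N with
  | zero =>
    rw [polyPair_eq_sum, if_pos (Subsingleton.elim _ _)]
    have h : (Finset.Iic fun i : Fin 0 => ℓ i.castSucc) = {default} := by
      ext x
      simp [Subsingleton.elim x default]
    simp [h, total, hahnVal, binWeight]
  | succ d ih =>
    obtain ⟨ν, n, rfl⟩ : ∃ ν' n, ν = (Fin.snoc ν' n : Fin (d + 1) → ℕ) :=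
      ⟨Fin.init ν, ν (Fin.last d), (Fin.snoc_init_self ν).symm⟩
    obtain ⟨μ, m, rfl⟩ : ∃ μ' m, μ = (Fin.snoc μ' m : Fin (d + 1) → ℕ) :=
      ⟨Fin.init μ, μ (Fin.last d), (Fin.snoc_init_self μ).symm⟩
    rw [snoc_mem_H] at hν hμ
    obtain ⟨⟨hna, hnb, hnN⟩, hν⟩ := hν
    obtain ⟨⟨hma, hmb, hmN⟩, hμ⟩ := hμ
    rw [polyPair_snoc hna hnb hnN hma hmb hmN]
    by_cases hnm : n = m
    · subst hnm
      rw [if_pos rfl, ih hν hμ]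
      have hiff : (Fin.snoc ν n : Fin (d + 1) → ℕ) = Fin.snoc μ n ↔ ν = μ :=
        ⟨fun h => by simpa using congrArg Fin.init h, fun h => by rw [h]⟩
      simp only [hiff]
      split_ifs with h
      · rw [Fin.prod_univ_castSucc, total_merge hna hnb, total_snoc, nuTail_last, ellTail_last]
        simp only [Fin.snoc_castSucc, Fin.snoc_last, nuTail_snoc_castSucc, ellTail_merge hna hnb,
          merge_castSucc, mul_add, Nat.add_sub_add_right, mul_zero, Nat.sub_zero]
        rw [add_comm (total ν) n, Nat.sub_add_eq]
        ring
      · rw [mul_zero]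
    · rw [if_neg hnm, if_neg]
      intro h
      exact hnm (by simpa using congrFun h (Fin.last d))

theorem polyPair_self_pos {d : ℕ} {ℓ : Fin (d + 1) → ℕ} {N : ℕ} {ν : Fin d → ℕ}
    (hν : ν ∈ H ℓ N) : 0 < polyPair ℓ N ν ν := by
  rw [polyPair_eq hν hν, if_pos rfl]
  obtain ⟨h1, h2, h3, h4⟩ := (mem_H ℓ N ν).mp hν
  refine mul_pos (Finset.prod_pos fun j _ => normFactor_pos (h1 j) ?_) ?_
  · have := h4 j
    omega
  · exact_mod_cast Nat.choose_pos (by omega)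

/-! ### Normalization -/

/-- The constant factors of `hahnPoly`. -/
def hahnConst {d : ℕ} (ℓ : Fin (d + 1) → ℕ) (N : ℕ) (ν : Fin d → ℕ) : ℝ :=
  (-1) ^ total ν / poch (-(N : ℝ)) (total ν) *
    ∏ j : Fin d, poch (-(ℓ j.castSucc : ℝ)) (ν j) / poch (aParam ℓ ν j + 1) (ν j)

theorem eval_hahnPoly {d : ℕ} (ℓ : Fin (d + 1) → ℕ) (N : ℕ) (ν x : Fin d → ℕ) :
    eval (toReal x) (hahnPoly ℓ N ν) = hahnConst ℓ N ν * hahnVal ℓ N ν x := by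
  have h : ∀ j, eval (toReal x) (hahnCleared (ν j) (X j) (-(ℓ j.castSucc : ℝ) - 1) (aParam ℓ ν j)
      (mParam N ν j)) = hahnCleared (ν j) (x j : ℝ) (-(ℓ j.castSucc : ℝ) - 1) (aParam ℓ ν j)
      ((N : ℝ) - ∑ i ∈ Finset.Iio j, (x i : ℝ) - (nuTail ν j : ℝ)) := fun j => by
    have := hahnCleared_map (aeval (toReal x) : MvPolynomial (Fin d) ℝ →ₐ[ℝ] ℝ) (ν j) (X j)
      (-(ℓ j.castSucc : ℝ) - 1) (aParam ℓ ν j) (mParam N ν j)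
    simpa [mParam, toReal, coe_aeval_eq_eval] using this
  rw [hahnPoly, map_mul, map_prod, hahnConst, hahnVal, mul_assoc, ← Finset.prod_mul_distrib, eval_C]
  congr 1
  refine Finset.prod_congr rfl fun j _ => ?_
  rw [map_mul, eval_C, h]

theorem poch_neg_natCast_div_factorial {m k : ℕ} (h : k ≤ m) :
    poch (-(m : ℝ)) k / (k.factorial : ℝ) = (-1) ^ k * (m.choose k : ℝ) := by
  obtain ⟨p, rfl⟩ := Nat.exists_eq_add_of_le' h
  rw [poch_neg_natCast, Nat.cast_choose ℝ h, Nat.add_sub_cancel]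
  field_simp

theorem total_castSucc {d : ℕ} (ℓ : Fin (d + 1) → ℕ) :
    total ℓ = total (fun i : Fin d => ℓ i.castSucc) + ℓ (Fin.last d) := by
  simp [total, Fin.sum_univ_castSucc]

theorem le_total_of_mem_V {d : ℕ} {ℓ : Fin (d + 1) → ℕ} {N : ℕ} {x : Fin d → ℕ} (hx : x ∈ V ℓ N) :
    N ≤ total ℓ := by
  obtain ⟨h1, h2, h3⟩ := (mem_V ℓ N x).mp hx
  have : total x ≤ total fun i : Fin d => ℓ i.castSucc := Finset.sum_le_sum fun i _ => h1 i
  rw [total_castSucc]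
  omega

theorem weight_eq {d : ℕ} {ℓ : Fin (d + 1) → ℕ} {N : ℕ} {x : Fin d → ℕ} (hx : x ∈ V ℓ N) :
    weight ℓ N x = binWeight ℓ N x / ((total ℓ).choose N : ℝ) := by
  have hN := le_total_of_mem_V hx
  obtain ⟨h1, h2, h3⟩ := (mem_V ℓ N x).mp hx
  have hp : ∏ i : Fin d, poch (-(ℓ i.castSucc : ℝ)) (x i) / ((x i).factorial : ℝ) =
      (-1) ^ total x * ∏ i : Fin d, ((ℓ i.castSucc).choose (x i) : ℝ) := by
    rw [total, ← Finset.prod_pow_eq_pow_sum, ← Finset.prod_mul_distrib]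
    exact Finset.prod_congr rfl fun i _ => poch_neg_natCast_div_factorial (h1 i)
  have hs : (-1 : ℝ) ^ N = (-1) ^ total x * (-1) ^ (N - total x) := by
    rw [← pow_add, Nat.add_sub_cancel' h3]
  have hs0 : (-1 : ℝ) ^ N ≠ 0 := by simp
  have hc : ((total ℓ).choose N : ℝ) ≠ 0 := by exact_mod_cast (Nat.choose_pos hN).ne'
  rw [weight, binWeight, hp, poch_neg_natCast_div_factorial (by omega),
    ← inv_div, poch_neg_natCast_div_factorial hN]
  field_simp
  rw [hs]
  ring

theorem inner_hahnPoly {d : ℕ} (ℓ : Fin (d + 1) → ℕ) (N : ℕ) (ν μ : Fin d → ℕ) :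
    inner ℓ N (hahnPoly ℓ N ν) (hahnPoly ℓ N μ) =
      hahnConst ℓ N ν * hahnConst ℓ N μ * polyPair ℓ N ν μ / ((total ℓ).choose N : ℝ) := by
  rw [inner, polyPair, Finset.mul_sum, Finset.sum_div]
  refine Finset.sum_congr rfl fun x hx => ?_
  rw [eval_hahnPoly, eval_hahnPoly, weight_eq hx]
  ring

/-- The factor of `B_ν` with index `j`, up to sign, for `a = ℓ_j`, `b = -(a_j + 1)`, `n = ν_j`. -/
theorem sq_mul_normFactor {a b n : ℕ} (ha : n ≤ a) (hb : n ≤ b) :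
    (poch (-(a : ℝ)) n / poch (-(b : ℝ)) n) ^ 2 * normFactor a b n =
      (-1) ^ n * (poch (-((a + b + 1 : ℕ) : ℝ)) (2 * n) * poch (-(a : ℝ)) n * (n.factorial : ℝ) /
        (poch (-((a + b + 1 : ℕ) : ℝ)) n * poch (-(b : ℝ)) n)) := by
  have h1 := poch_neg_natCast_ne_zero ha
  have h2 := poch_neg_natCast_ne_zero hb
  have h3 := poch_neg_natCast_ne_zero (show n ≤ a + b + 1 by omega)
  have h4 := poch_neg_natCast_div_factorial (show n ≤ a + b + 1 - n by omega)
  have h5 : -((a + b + 1 : ℕ) : ℝ) + n = -((a + b + 1 - n : ℕ) : ℝ) := by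
    rw [Nat.cast_sub (by omega)]
    ring
  rw [div_eq_iff (by positivity)] at h4
  have hs : ((-1 : ℝ) ^ n) ^ 2 = 1 := by rw [← pow_mul, mul_comm, pow_mul]; simp
  rw [two_mul, poch_add, h5, h4, normFactor]
  field_simp
  rw [hs, mul_one]

/-- The factor of `B_ν` in front of the product, with `L = |ℓ|` and `s = |ν|`. -/
theorem sq_inv_mul_choose_div {N L s : ℕ} (h1 : s ≤ N) (h2 : s + N ≤ L) :
    (1 / poch (-(N : ℝ)) s) ^ 2 * ((L - 2 * s).choose (N - s) : ℝ) / (L.choose N : ℝ) =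
      poch (-(L : ℝ)) (N + s) /
        (poch (-(N : ℝ)) s * poch (-(L : ℝ)) N * poch (-(L : ℝ)) (2 * s)) := by
  obtain ⟨k, rfl⟩ := Nat.exists_eq_add_of_le' h1
  obtain ⟨r, rfl⟩ := Nat.exists_eq_add_of_le' h2
  have e1 := poch_neg_natCast k s
  have e2 := poch_neg_natCast r (k + s + s)
  have e3 := poch_neg_natCast (r + s) (k + s)
  have e4 := poch_neg_natCast (r + k) (2 * s)
  have e5 := Nat.cast_add_choose ℝ (a := k) (b := r)
  have e6 := Nat.cast_add_choose ℝ (a := k + s) (b := r + s)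
  rw [show r + (k + s + s) = r + (s + (k + s)) by ring] at e2
  rw [show r + s + (k + s) = r + (s + (k + s)) by ring] at e3
  rw [show r + k + 2 * s = r + (s + (k + s)) by ring] at e4
  rw [show k + s + (r + s) = r + (s + (k + s)) by ring] at e6
  rw [Nat.add_sub_cancel, show r + (s + (k + s)) - 2 * s = k + r by omega, e1, e2, e3, e4, e5, e6,
    show r + k = k + r by ring]
  have h0 : ((-1 : ℝ) ^ k) ≠ 0 := by simp
  have h0' : ((-1 : ℝ) ^ s) ≠ 0 := by simp
  have hs : ((-1 : ℝ) ^ s) ^ 2 = 1 := by rw [← pow_mul, mul_comm, pow_mul]; simp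
  have h2s : (-1 : ℝ) ^ (2 * s) = 1 := by rw [pow_mul]; simp
  rw [pow_add, pow_add, h2s]
  field_simp
  exact hs.symm

theorem aParam_add_one {d : ℕ} {ℓ : Fin (d + 1) → ℕ} {ν : Fin d → ℕ} {j : Fin d}
    (h : 2 * nuTail ν j ≤ ellTail ℓ j) :
    aParam ℓ ν j + 1 = -((ellTail ℓ j - 2 * nuTail ν j : ℕ) : ℝ) := by
  rw [aParam, Nat.cast_sub h]
  push_cast
  ring

theorem hahnConst_ne_zero {d : ℕ} {ℓ : Fin (d + 1) → ℕ} {N : ℕ} {ν : Fin d → ℕ}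
    (hν : ν ∈ H ℓ N) : hahnConst ℓ N ν ≠ 0 := by
  obtain ⟨h1, h2, h3, h4⟩ := (mem_H ℓ N ν).mp hν
  refine mul_ne_zero (div_ne_zero (by simp) (poch_neg_natCast_ne_zero h2))
    (Finset.prod_ne_zero_iff.mpr fun j _ => ?_)
  have := h4 j
  rw [aParam_add_one (by omega)]
  exact div_ne_zero (poch_neg_natCast_ne_zero (h1 j)) (poch_neg_natCast_ne_zero (by omega))

/-- The squared norm of `Q_ν` agrees with the product formula `B_ν`. -/
theorem norm_eq_B {d : ℕ} {ℓ : Fin (d + 1) → ℕ} {N : ℕ} {ν : Fin d → ℕ} (hν : ν ∈ H ℓ N) :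
    hahnConst ℓ N ν * hahnConst ℓ N ν * polyPair ℓ N ν ν / ((total ℓ).choose N : ℝ) =
      B ℓ N ν := by
  rw [polyPair_eq hν hν, if_pos rfl]
  obtain ⟨h1, h2, h3, h4⟩ := (mem_H ℓ N ν).mp hν
  have hprod : (∏ j : Fin d, poch (-(ℓ j.castSucc : ℝ)) (ν j) / poch (aParam ℓ ν j + 1) (ν j)) ^ 2 *
      ∏ j : Fin d, normFactor (ℓ j.castSucc) (ellTail ℓ j - 2 * nuTail ν j) (ν j) =
      (-1) ^ total ν * ∏ j : Fin d,
        poch (-(ℓ j.castSucc : ℝ) + aParam ℓ ν j) (2 * ν j) * poch (-(ℓ j.castSucc : ℝ)) (ν j) *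
            ((ν j).factorial : ℝ) /
          (poch (-(ℓ j.castSucc : ℝ) + aParam ℓ ν j) (ν j) * poch (aParam ℓ ν j + 1) (ν j)) := by
    rw [total, ← Finset.prod_pow_eq_pow_sum, ← Finset.prod_pow, ← Finset.prod_mul_distrib,
      ← Finset.prod_mul_distrib]
    refine Finset.prod_congr rfl fun j _ => ?_
    have h := h4 j
    have ha := aParam_add_one (ℓ := ℓ) (ν := ν) (j := j) (by omega)
    have hb : -(ℓ j.castSucc : ℝ) + aParam ℓ ν j =
        -((ℓ j.castSucc + (ellTail ℓ j - 2 * nuTail ν j) + 1 : ℕ) : ℝ) := by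
      push_cast at ha ⊢
      linear_combination ha
    rw [ha, hb]
    exact sq_mul_normFactor (h1 j) (by omega)
  have hs : ((-1 : ℝ) ^ total ν) ^ 2 = 1 := by rw [← pow_mul, mul_comm, pow_mul]; simp
  have hk := sq_inv_mul_choose_div h2 h3
  rw [B, mul_div_assoc ((-1) ^ total ν), ← hk, hahnConst]
  set P := ∏ j : Fin d, poch (-(ℓ j.castSucc : ℝ)) (ν j) / poch (aParam ℓ ν j + 1) (ν j)
  set Q := ∏ j : Fin d, normFactor (ℓ j.castSucc) (ellTail ℓ j - 2 * nuTail ν j) (ν j)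
  rw [show ∀ e p c c' : ℝ, e / p * P * (e / p * P) * (Q * c) / c' =
    e ^ 2 * ((1 / p) ^ 2 * c / c') * (P ^ 2 * Q) by intros; ring, hprod, hs]
  ring

theorem inner_hahnPoly_eq {d : ℕ} {ℓ : Fin (d + 1) → ℕ} {N : ℕ} {ν μ : Fin d → ℕ}
    (hν : ν ∈ H ℓ N) (hμ : μ ∈ H ℓ N) :
    inner ℓ N (hahnPoly ℓ N ν) (hahnPoly ℓ N μ) = if ν = μ then B ℓ N ν else 0 := by
  rw [inner_hahnPoly]
  split_ifs with h
  · subst h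
    exact norm_eq_B hν
  · rw [polyPair_eq hν hμ, if_neg h, mul_zero, zero_div]

theorem B_ne_zero {d : ℕ} {ℓ : Fin (d + 1) → ℕ} {N : ℕ} {ν : Fin d → ℕ} (hν : ν ∈ H ℓ N) :
    B ℓ N ν ≠ 0 := by
  rw [← norm_eq_B hν]
  have hc := hahnConst_ne_zero hν
  have hN : N ≤ total ℓ := by
    have := ((mem_H ℓ N ν).mp hν).2.2.1
    omega
  exact div_ne_zero (mul_ne_zero (mul_ne_zero hc hc) (polyPair_self_pos hν).ne')
    (by exact_mod_cast (Nat.choose_pos hN).ne')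

/-! ### The space `Π` -/

/-- The restriction of polynomials to the points of the polyhedron. -/
def restrict {d : ℕ} (ℓ : Fin (d + 1) → ℕ) (N : ℕ) : MvPolynomial (Fin d) ℝ →ₐ[ℝ] (V ℓ N → ℝ) :=
  AlgHom.pi fun x => aeval (toReal x.1)

theorem restrict_apply {d : ℕ} (ℓ : Fin (d + 1) → ℕ) (N : ℕ) (p : MvPolynomial (Fin d) ℝ)
    (x : V ℓ N) : restrict ℓ N p x = eval (toReal x.1) p := by
  simp [restrict]

theorem mem_vanishing_iff {d : ℕ} (ℓ : Fin (d + 1) → ℕ) (N : ℕ) (p : MvPolynomial (Fin d) ℝ) :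
    p ∈ vanishing ℓ N ↔ restrict ℓ N p = 0 := by
  rw [vanishing, mem_vanishingIdeal_iff, Set.forall_mem_image]
  simp [funext_iff, restrict_apply]

theorem linearIndependent_restrict {d : ℕ} (ℓ : Fin (d + 1) → ℕ) (N : ℕ) :
    LinearIndependent ℝ fun ν : H ℓ N => restrict ℓ N (hahnPoly ℓ N ν) := by
  rw [Fintype.linearIndependent_iff]
  intro c hc μ
  have h : ∑ ν : H ℓ N, c ν * inner ℓ N (hahnPoly ℓ N ν) (hahnPoly ℓ N μ) = 0 := by
    simp only [inner, Finset.mul_sum]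
    rw [Finset.sum_comm]
    refine Finset.sum_eq_zero fun x hx => ?_
    have hx := congrFun hc ⟨x, hx⟩
    simp only [Finset.sum_apply, Pi.smul_apply, smul_eq_mul, restrict_apply, Pi.zero_apply] at hx
    simp only [← mul_assoc, ← Finset.sum_mul, hx, zero_mul]
  rw [Finset.sum_eq_single μ] at h
  · rw [inner_hahnPoly_eq μ.2 μ.2, if_pos rfl] at h
    exact (mul_eq_zero.mp h).resolve_right (B_ne_zero μ.2)
  · intro ν _ hν
    rw [inner_hahnPoly_eq ν.2 μ.2, if_neg fun h => hν (Subtype.ext h), mul_zero]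
  · simp

/-- The `Q_ν` restricted to the polyhedron, a basis of the functions on it because there are as many
of them as points. -/
def functionBasis {d : ℕ} (ℓ : Fin (d + 1) → ℕ) (N : ℕ) : Module.Basis (H ℓ N) ℝ (V ℓ N → ℝ) :=
  basisOfLinearIndependentOfCardEqFinrank' _ (linearIndependent_restrict ℓ N) (by
    simp [card_H_eq_card_V])

theorem functionBasis_apply {d : ℕ} (ℓ : Fin (d + 1) → ℕ) (N : ℕ) (ν : H ℓ N) :
    functionBasis ℓ N ν = restrict ℓ N (hahnPoly ℓ N ν) := by
  simp [functionBasis]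

theorem restrict_surjective {d : ℕ} (ℓ : Fin (d + 1) → ℕ) (N : ℕ) :
    Function.Surjective (restrict ℓ N) := fun f =>
  ⟨∑ ν : H ℓ N, (functionBasis ℓ N).repr f ν • hahnPoly ℓ N ν, by
    simp only [map_sum, map_smul, ← functionBasis_apply, Module.Basis.sum_repr]⟩

/-- `Π` is the algebra of all functions on the polyhedron. -/
def piEquiv {d : ℕ} (ℓ : Fin (d + 1) → ℕ) (N : ℕ) : PiSpace ℓ N ≃ₐ[ℝ] (V ℓ N → ℝ) :=
  (Ideal.quotientEquivAlgOfEq ℝ (Ideal.ext fun p => mem_vanishing_iff ℓ N p)).trans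
    (Ideal.quotientKerAlgEquivOfSurjective (restrict_surjective ℓ N))

theorem piEquiv_mk {d : ℕ} (ℓ : Fin (d + 1) → ℕ) (N : ℕ) (p : MvPolynomial (Fin d) ℝ) :
    piEquiv ℓ N (Ideal.Quotient.mk (vanishing ℓ N) p) = restrict ℓ N p := rfl

end

end PolyHahn

theorem theorem2p4 (d N : ℕ) (hd : 1 ≤ d) (hN : 1 ≤ N) (ℓ : Fin (d + 1) → ℕ)
    (hℓ : ∀ i, 1 ≤ ℓ i) (hℓN : ∀ i, ℓ i ≤ N) (hpair : ∀ i j, i < j → N ≤ ℓ i + ℓ j) :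
    (∀ ν ∈ PolyHahn.H ℓ N, ∀ μ ∈ PolyHahn.H ℓ N,
      PolyHahn.inner ℓ N (PolyHahn.hahnPoly ℓ N ν) (PolyHahn.hahnPoly ℓ N μ) =
        if ν = μ then PolyHahn.B ℓ N ν else 0) ∧
    (∃ b : Module.Basis (PolyHahn.H ℓ N) ℝ (PolyHahn.PiSpace ℓ N),
      ∀ ν : PolyHahn.H ℓ N,
        b ν = Ideal.Quotient.mk (PolyHahn.vanishing ℓ N) (PolyHahn.hahnPoly ℓ N ν)) ∧
    (PolyHahn.H ℓ N).card = (PolyHahn.V ℓ N).card ∧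
    (PolyHahn.V ℓ N).card = Module.finrank ℝ (PolyHahn.PiSpace ℓ N) := by
  refine ⟨fun ν hν μ hμ => PolyHahn.inner_hahnPoly_eq hν hμ,
    ⟨(PolyHahn.functionBasis ℓ N).map (PolyHahn.piEquiv ℓ N).symm.toLinearEquiv, fun ν => ?_⟩,
    PolyHahn.card_H_eq_card_V ℓ N, ?_⟩
  · rw [Module.Basis.map_apply, PolyHahn.functionBasis_apply, ← PolyHahn.piEquiv_mk]
    exact (PolyHahn.piEquiv ℓ N).symm_apply_apply _
  · rw [(PolyHahn.piEquiv ℓ N).toLinearEquiv.finrank_eq, Module.finrank_fintype_fun_eq_card,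
      Fintype.card_coe]
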